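/- We work over $\mathbb{C}$. Let $G$ be a reductive (not necessarily connected) algebraic group over $\mathbb{C}$, i.e. an affine group scheme of finite type over $\mathbb{C}$ with trivial unipotent radical. Let $X$ be a projective scheme over $\mathbb{C}$ with a $G$-action, let $\mathcal{M}$ be a $G$-linearized line bundle on $X$, let $x\in X(\mathbb{C})$, and let $\lambda\colon\mathbb{C}^*=\mathbb{G}_m\to G$ be a one parameter subgroup, i.e. a homomorphism of algebraic groups. Write $x_\infty:=\lim_{z\to\infty}\lambda(z)\cdot x$, i.e. the value at $z=\infty$ of the extension of the morphism $\mathbb{C}^*\to X$, $z\mapsto\lambda(z)\cdot x$, to $\mathbb{C}^*\cup\{\infty\}$. If $x_\infty$ exists and is fixed under the $\mathbb{C}^*$-action induced by $\lambda$, and $\mathbb{C}^*$ acts on the fibre $\mathcal{M}\langle x_\infty\rangle$ by the character $z\mapsto z^{\gamma}$, $\gamma\in\mathbb{Z}$, one sets $$\mu_{\mathcal{M}}(\lambda,x):=-\gamma .$$ **Lemma.** Let $G$ be a reductive algebraic group over $\mathbb{C}$, let $X$ and $Y$ be projective schemes over $\mathbb{C}$ equipped with $G$-actions, and let $\pi\colon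 X\to Y$ be a finite $G$-equivariant morphism over $\mathbb{C}$. Let $\mathcal{L}$ be a $G$-linearized ample line bundle on $Y$, and give $\pi^*\mathcal{L}$ the induced linearization. Then, for every point $x\in X(\mathbb{C})$ and every one parameter subgroup $\lambda\colon\mathbb{C}^*\to G$, the integers $\mu_{\pi^*\mathcal{L}}(\lambda,x)$ and $\mu_{\mathcal{L}}(\lambda,\pi(x))$ are well defined (each exists and is unique), and $$\mu_{\pi^*\mathcal{L}}(\lambda,x)=\mu_{\mathcal{L}}(\lambda,\pi(x)).$$ -/

import Mathlib

open CategoryTheory AlgebraicGeometry MonoidalCategory CartesianMonoidalCategory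
open scoped Topology MonObj LaurentPolynomial Polynomial

noncomputable section

namespace GIT

/-! ### Schemes over the complex numbers -/

/-- `Spec ℂ`. -/
abbrev SpecC : Scheme.{0} := Spec (.of ℂ)

/-- The category of schemes over `Spec ℂ`. -/
abbrev SchC : Type 1 := Over SpecC

/-- The set `X(ℂ)` of complex points of `X`. -/
abbrev Points (X : SchC) : Type := 𝟙_ SchC ⟶ X

attribute [local instance] MvPolynomial.gradedAlgebra

/-- The structure morphism of `ℙⁿ = Proj ℂ[x₀, …, xₙ]` over `Spec ℂ`. -/
def projToSpec (n : ℕ) :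
    Proj (MvPolynomial.homogeneousSubmodule (Fin (n + 1)) ℂ) ⟶ SpecC :=
  Proj.toSpecZero (MvPolynomial.homogeneousSubmodule (Fin (n + 1)) ℂ) ≫
    Spec.map (CommRingCat.ofHom
      (algebraMap ℂ (MvPolynomial.homogeneousSubmodule (Fin (n + 1)) ℂ 0)))

/-- `X` is a projective scheme: it is isomorphic over `ℂ` to a closed subscheme of some `ℙⁿ`. -/
def IsProjective (X : SchC) : Prop :=
  ∃ (n : ℕ) (i : X.left ⟶ Proj (MvPolynomial.homogeneousSubmodule (Fin (n + 1)) ℂ)),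
    IsClosedImmersion i ∧ i ≫ projToSpec n = X.hom

/-! ### Reductive groups -/

section Reductive

variable (G : SchC) [GrpObj G]

/-- The value `f(g) ∈ ℂ` of a regular function `f` on `G` at a complex point `g`. -/
def evalAt {G : SchC} (f : Γ(G.left, ⊤)) (g : Points G) : ℂ :=
  (Scheme.ΓSpecIso (.of ℂ)).hom (Scheme.Hom.appTop (X := SpecC) g.left f)

/-- A representation of the group `G(ℂ)` on `ℂⁿ` is rational if its matrix coefficients are
regular functions on `G`. -/
def IsRational {n : ℕ} (ρ : Representation ℂ (Points G) (Fin n → ℂ)) : Prop :=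
  ∀ (v : Fin n → ℂ) (i : Fin n), ∃ f : Γ(G.left, ⊤), ∀ g : Points G, evalAt f g = ρ g v i

/-- `g ∈ G(ℂ)` is unipotent: it acts unipotently in every rational representation. -/
def IsUnipotent (g : Points G) : Prop :=
  ∀ (n : ℕ) (ρ : Representation ℂ (Points G) (Fin n → ℂ)), IsRational G ρ →
    IsNilpotent (ρ g - 1)

/-- The Zariski topology on `G(ℂ)`. -/
abbrev zariskiTopology : TopologicalSpace (Points G) :=
  TopologicalSpace.induced (fun g : Points G => g.left (IsLocalRing.closedPoint ℂ)) inferInstance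

/-- `G` is a reductive (not necessarily connected) algebraic group over `ℂ`: an affine group
scheme of finite type with trivial unipotent radical, i.e. whose only Zariski closed, connected,
normal subgroup that consists of unipotent elements is the trivial one. -/
structure IsReductive : Prop where
  affine : IsAffine G.left
  finiteType : LocallyOfFiniteType G.hom
  unipotentRadical : ∀ N : Subgroup (Points G), N.Normal →
    IsClosed[zariskiTopology G] (N : Set (Points G)) →
    @IsConnected _ (zariskiTopology G) (N : Set (Points G)) →
    (∀ g ∈ N, IsUnipotent G g) → N = ⊥

end Reductive

/-! ### Line bundles and ampleness -/

section LineBundle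

variable {X : Scheme.{0}}

/-- A line bundle: an `𝒪_X`-module that is locally isomorphic to `𝒪_X`. -/
def IsLineBundle (L : X.Modules) : Prop :=
  ∀ x : X, ∃ U : X.Opens, x ∈ U ∧
    Nonempty (L.restrict U.ι ≅ SheafOfModules.unit U.toScheme.ringCatSheaf)

/-- The tensor product of `𝒪_X`-modules: the sheaf associated with `U ↦ M(U) ⊗ N(U)`. -/
def tensor (M N : X.Modules) : X.Modules :=
  (PresheafOfModules.sheafification (𝟙 X.ringCatSheaf.obj)).obj
    (PresheafOfModules.Monoidal.tensorObj (R := X.presheaf) M.val N.val)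

/-- `tensorPow L n` is `L^{⊗ n}`. -/
def tensorPow (L : X.Modules) : ℕ → X.Modules
  | 0 => SheafOfModules.unit X.ringCatSheaf
  | n + 1 => tensor (tensorPow L n) L

/-- The open set `X_s` on which the global section `s` of the line bundle `M` does not vanish:
the largest open set on which `f ↦ f • s` is an isomorphism `𝒪_X → M`. -/
def nonvanishing (M : X.Modules) (s : Γ(M, ⊤)) : X.Opens :=
  sSup {U | ∀ V : X.Opens, V ≤ U →
    Function.Bijective fun f : Γ(X, V) =>
      f • M.presheaf.map (homOfLE (le_top : V ≤ ⊤)).op s}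

/-- A line bundle on a quasi-compact scheme is ample if the affine open sets `X_s`, for `s` a
section of a positive power of `L`, cover `X`. -/
structure IsAmple (L : X.Modules) : Prop where
  lineBundle : IsLineBundle L
  compact : CompactSpace X
  exists_section : ∀ x : X, ∃ (n : ℕ) (s : Γ(tensorPow L n, ⊤)), 0 < n ∧
    x ∈ nonvanishing (tensorPow L n) s ∧ IsAffineOpen (nonvanishing (tensorPow L n) s)

end LineBundle

/-! ### Linearizations -/

open Scheme.Modules in
/-- A `G`-linearization of the `𝒪_X`-module `L`, where `G` acts on `X`: for every scheme `T` over
`ℂ`, every `g ∈ G(T)` and every `x, y ∈ X(T)` with `g • x = y`, an isomorphism `x^* L ≅ y^* L`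
(fibrewise, the linear map `L⟨x⟩ → L⟨g • x⟩` by which `g` acts), compatible with base change and
with the multiplication of `G`. -/
structure Linearization (G : SchC) [GrpObj G] {X : SchC} [ModObj G X] (L : X.left.Modules) where
  /-- The action of `g` from `x^* L` to `y^* L`. -/
  act : ∀ {T : SchC} (g : T ⟶ G) (x y : T ⟶ X), g • x = y →
    ((pullback x.left).obj L ≅ (pullback y.left).obj L)
  act_mul : ∀ {T : SchC} (g h : T ⟶ G) (x y z : T ⟶ X) (hxy : h • x = y) (hyz : g • y = z)
    (hxz : (g * h) • x = z), act (g * h) x z hxz = act h x y hxy ≪≫ act g y z hyz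
  act_comp : ∀ {T T' : SchC} (f : T' ⟶ T) (g : T ⟶ G) (x y : T ⟶ X) (hxy : g • x = y)
    (hxy' : (f ≫ g) • (f ≫ x) = f ≫ y),
    (pullback f.left).map (act g x y hxy).hom ≫ (pullbackComp f.left y.left).hom.app L =
      (pullbackComp f.left x.left).hom.app L ≫ (act (f ≫ g) (f ≫ x) (f ≫ y) hxy').hom

namespace Linearization

open Scheme.Modules

variable {G : SchC} [GrpObj G] {X Y : SchC} [ModObj G X] [ModObj G Y]

lemma pullbackComp_assoc {X Y Z T : Scheme.{0}} (f : X ⟶ Y) (g : Y ⟶ Z) (h : Z ⟶ T)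
    (L : T.Modules) :
    (pullbackComp f g).hom.app ((Scheme.Modules.pullback h).obj L) ≫
        (pullbackComp (f ≫ g) h).hom.app L =
      (Scheme.Modules.pullback f).map ((pullbackComp g h).hom.app L) ≫
        (pullbackComp f (g ≫ h)).hom.app L ≫ eqToHom (by rw [Category.assoc]) := by
  have H := congr(($(pseudofunctor_associativity f g h)).app L)
  simp only [NatTrans.comp_app, Functor.whiskerRight_app, Functor.associator_hom_app,
    Functor.whiskerLeft_app, Category.id_comp, eqToHom_app] at H
  rw [← H, ← NatTrans.comp_app_assoc, Iso.hom_inv_id, NatTrans.id_app, Category.id_comp,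
    ← Functor.map_comp_assoc, ← NatTrans.comp_app, Iso.hom_inv_id, NatTrans.id_app]
  simp

lemma act_congr {L : Y.left.Modules} (Φ : Linearization G L) {T : SchC} (g : T ⟶ G)
    {x x' y y' : T ⟶ Y} (hx : x = x') (hy : y = y') (h : g • x = y) (h' : g • x' = y') :
    (Φ.act g x y h).hom =
      eqToHom (by rw [hx]) ≫ (Φ.act g x' y' h').hom ≫ eqToHom (by rw [hy]) := by
  subst hx hy
  simp

lemma pullback_act_comp_aux {T' T X Y : Scheme.{0}} (f : T' ⟶ T) (x y : T ⟶ X) (p : X ⟶ Y)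
    (L : Y.Modules)
    (A : (Scheme.Modules.pullback (x ≫ p)).obj L ⟶ (Scheme.Modules.pullback (y ≫ p)).obj L)
    (A' : (Scheme.Modules.pullback (f ≫ x ≫ p)).obj L ⟶
      (Scheme.Modules.pullback (f ≫ y ≫ p)).obj L)
    (A'' : (Scheme.Modules.pullback ((f ≫ x) ≫ p)).obj L ⟶
      (Scheme.Modules.pullback ((f ≫ y) ≫ p)).obj L)
    (hA : (Scheme.Modules.pullback f).map A ≫ (pullbackComp f (y ≫ p)).hom.app L =
      (pullbackComp f (x ≫ p)).hom.app L ≫ A')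
    (hA' : A'' = eqToHom (by rw [Category.assoc]) ≫ A' ≫ eqToHom (by rw [Category.assoc])) :
    (Scheme.Modules.pullback f).map
        ((pullbackComp x p).hom.app L ≫ A ≫ (pullbackComp y p).inv.app L) ≫
        (pullbackComp f y).hom.app ((Scheme.Modules.pullback p).obj L) =
      (pullbackComp f x).hom.app ((Scheme.Modules.pullback p).obj L) ≫
        (pullbackComp (f ≫ x) p).hom.app L ≫ A'' ≫ (pullbackComp (f ≫ y) p).inv.app L := by
  rw [← cancel_mono ((pullbackComp (f ≫ y) p).hom.app L)]
  simp only [Category.assoc, pullbackComp_assoc, Iso.inv_hom_id_app, Category.comp_id, hA',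
    Functor.map_comp, reassoc_of% pullbackComp_assoc f x p L]
  rw [← Functor.map_comp_assoc ((Scheme.Modules.pullback f)) ((pullbackComp y p).inv.app L),
    Iso.inv_hom_id_app, CategoryTheory.Functor.map_id, Category.id_comp, reassoc_of% hA]
  simp

/-- The linearization of `π^* L` induced by a linearization of `L`, for `π` equivariant: under
`x^* π^* L = (π x)^* L` the action of `g` is the given one. -/
def pullback (π : X ⟶ Y) [IsModHom G π] {L : Y.left.Modules} (Φ : Linearization G L) :
    Linearization G ((Scheme.Modules.pullback π.left).obj L) where
  act g x y hxy :=
    (pullbackComp x.left π.left).app L ≪≫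
      Φ.act g (x ≫ π) (y ≫ π) (by rw [← hxy, IsModHom.map_smul]) ≪≫
      ((pullbackComp y.left π.left).app L).symm
  act_mul g h x y z hxy hyz hxz := by
    rw [Φ.act_mul g h (x ≫ π) (y ≫ π) (z ≫ π) (by rw [← hxy, IsModHom.map_smul])
      (by rw [← hyz, IsModHom.map_smul])]
    ext1
    simp
  act_comp f g x y hxy hxy' := by
    have h := Φ.act_comp f g (x ≫ π) (y ≫ π) (by rw [← hxy, IsModHom.map_smul])
      (by rw [← hxy, IsModHom.map_smul, ModObj.comp_smul])
    exact pullback_act_comp_aux f.left x.left y.left π.left L _ _ _ h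
      (Φ.act_congr (f ≫ g) (Category.assoc f x π) (Category.assoc f y π) _ _)

end Linearization

/-! ### The weight `μ` -/

/-- The multiplicative group `ℂ^* = Spec ℂ[T, T⁻¹]`; its group structure is the one induced by the
Hopf algebra structure of `ℂ[T, T⁻¹]`. -/
abbrev Gm : SchC := (Spec (.of ℂ[T;T⁻¹])).asOver SpecC

/-- The affine line `Spec ℂ[X]`. -/
abbrev A1 : SchC := (Spec (.of ℂ[X])).asOver SpecC

/-- The complex point `z` of `Gm`. -/
def Gm.point (z : ℂˣ) : Points Gm :=
  Over.homMk (Spec.map (CommRingCat.ofHom (LaurentPolynomial.eval₂ (RingHom.id ℂ) z))) <| by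
    change Spec.map _ ≫ Spec.map _ = 𝟙 _
    rw [← Spec.map_comp, ← CommRingCat.ofHom_comp, ← Spec.map_id]
    congr 2
    ext a
    simp

/-- The origin of the affine line. -/
def A1.zero : Points A1 :=
  Over.homMk (Spec.map (CommRingCat.ofHom (Polynomial.evalRingHom (0 : ℂ)))) <| by
    change Spec.map _ ≫ Spec.map _ = 𝟙 _
    rw [← Spec.map_comp, ← CommRingCat.ofHom_comp, ← Spec.map_id]
    congr 2
    ext a
    simp

/-- The open immersion `z ↦ z⁻¹` of `Gm` into the affine line; the origin of the affine line
corresponds to `z = ∞`. -/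
def Gm.inv : Gm ⟶ A1 :=
  Over.homMk (Spec.map (CommRingCat.ofHom
    (Polynomial.eval₂RingHom LaurentPolynomial.C (LaurentPolynomial.T (-1))))) <| by
    change Spec.map _ ≫ Spec.map _ = Spec.map _
    rw [← Spec.map_comp, ← CommRingCat.ofHom_comp]
    congr 2
    ext a
    simp [LaurentPolynomial.algebraMap_apply]

section Weight

variable {G : SchC} [GrpObj G] {X : SchC} [ModObj G X]

/-- `x_∞ = lim_{z → ∞} λ(z) • x`: the morphism `Gm → X`, `z ↦ λ(z) • x`, extends to
`z = ∞` with value `x_∞` there. -/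
def IsLimit (l : Gm ⟶ G) (x xinf : Points X) : Prop :=
  ∃ σ : A1 ⟶ X, Gm.inv ≫ σ = l • (toUnit Gm ≫ x) ∧ A1.zero ≫ σ = xinf

/-- The pullback `x^* L` of `L` to `Spec ℂ` along a complex point `x`. -/
abbrev fibreSheaf (L : X.left.Modules) (x : Points X) : SpecC.Modules :=
  (Scheme.Modules.pullback x.left).obj L

/-- A complex number as a regular function on `Spec ℂ`. -/
abbrev scalar (a : ℂ) : Γ(SpecC, ⊤) := (Scheme.ΓSpecIso (.of ℂ)).inv a

/-- The fibre `L⟨x⟩` of `L` at a complex point `x`: the module of global sections of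
`x^* L` over `Γ(Spec ℂ, 𝒪) = ℂ`. -/
abbrev fibre (L : X.left.Modules) (x : Points X) : Type :=
  Γ(fibreSheaf L x, (⊤ : SpecC.Opens))

variable {L : X.left.Modules}

/-- The point `x` is fixed under `λ`, and `ℂ^*` acts on the fibre `L⟨x⟩` by `z ↦ z ^ c`. -/
def HasWeight (Φ : Linearization G L) (l : Gm ⟶ G) (x : Points X) (c : ℤ) : Prop :=
  ∀ z : ℂˣ, ∃ h : (Gm.point z ≫ l) • x = x, ∀ s : fibre L x,
    (Φ.act (Gm.point z ≫ l) x x h).hom.app ⊤ s = scalar ((z ^ c : ℂˣ) : ℂ) • s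

/-- `m` is a value of `μ_L(λ, x)`: `m = -c`, where `ℂ^*` acts on the fibre of `L` at
`x_∞ = lim_{z → ∞} λ(z) • x` by `z ↦ z ^ c`. -/
def HasMu (Φ : Linearization G L) (l : Gm ⟶ G) (x : Points X) (m : ℤ) : Prop :=
  ∃ (xinf : Points X) (c : ℤ), IsLimit l x xinf ∧ HasWeight Φ l xinf c ∧ m = -c

/-- The number `μ_L(λ, x)`. -/
def mu (Φ : Linearization G L) (l : Gm ⟶ G) (x : Points X) : ℤ :=
  Classical.epsilon (HasMu Φ l x)

end Weight

end GIT

end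

/-!
The morphism `z ↦ λ(z) • x` extends from `Gm` to the affine line, glued at `z = ∞`, by the
valuative criterion: the local rings of the line are valuation rings. Multiplication by `λ(z)` and
scaling of the affine line by `z⁻¹` agree on `Gm`, hence on the whole line, and scaling fixes the
origin; so the limit `x_∞` is fixed by `λ`. A trivialization of `L⟨x_∞⟩` pulls back to `Gm`, where
`λ` acts on `𝒪` by a unit of `ℂ[T, T⁻¹]`, that is by some `a T ^ c`, and `a = 1` since `λ(1) = 1`.

Finally `π` sends `x_∞` to the limit of `π(x)`, and the fibre of `π^* L` at `x_∞` is the fibre of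
`L` at `π(x_∞)`, with the same action of `λ`.
-/

noncomputable section

namespace GIT

universe u

section Modules

variable {X Y : Scheme.{u}}

/-- Multiplication by global functions, as a ring homomorphism to the endomorphisms of an
`𝒪_X`-module. -/
def smulEnd (M : X.Modules) : Γ(X, ⊤) →+* End M where
  toFun u := ⟨PresheafOfModules.homMk
    { app := fun U => M.smul (X.presheaf.map (homOfLE (le_top : U.unop ≤ ⊤)).op u)
      naturality := fun U V i => by
        refine Eq.symm ((M.map_comp_smul i.unop _).trans ?_)
        congr 2
        rw [← CategoryTheory.comp_apply, ← Functor.map_comp]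
        rfl }
    (fun U r m => smul_comm (M := Γ(X, U.unop)) (N := Γ(X, U.unop)) (α := Γ(M, U.unop)) _ r m)⟩
  map_one' := Scheme.Modules.hom_ext _ _ fun U => by
    ext s
    exact (congrArg (· • s) (map_one _)).trans (one_smul Γ(X, U) s)
  map_zero' := Scheme.Modules.hom_ext _ _ fun U => by
    ext s
    exact (congrArg (· • s) (map_zero _)).trans (zero_smul Γ(X, U) s)
  map_mul' u v := Scheme.Modules.hom_ext _ _ fun U => by
    ext s
    exact (congrArg (· • s) (map_mul _ u v)).trans (mul_smul (_ : Γ(X, U)) _ s)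
  map_add' u v := Scheme.Modules.hom_ext _ _ fun U => by
    ext s
    exact (congrArg (· • s) (map_add _ u v)).trans (add_smul (_ : Γ(X, U)) _ s)

lemma smulEnd_app (M : X.Modules) (u : Γ(X, ⊤)) (U : X.Opens) (s : Γ(M, U)) :
    (smulEnd M u).app U s = X.presheaf.map (homOfLE (le_top : U ≤ ⊤)).op u • s := rfl

lemma smulEnd_app_top (M : X.Modules) (u : Γ(X, ⊤)) (s : Γ(M, ⊤)) :
    (smulEnd M u).app ⊤ s = u • s := by
  rw [smulEnd_app]
  congr 1
  exact congr($(X.presheaf.map_id _) u)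

lemma smulEnd_comp {M N : X.Modules} (φ : M ⟶ N) (u : Γ(X, ⊤)) :
    smulEnd M u ≫ φ = φ ≫ smulEnd N u := by
  ext U s
  exact φ.app_smul _ s

lemma conj_smulEnd {M N : X.Modules} (e : M ≅ N) (u : Γ(X, ⊤)) :
    e.conj (smulEnd M u) = smulEnd N u := by
  rw [Iso.conj_apply, smulEnd_comp, e.inv_hom_id_assoc]

lemma pullback_map_smulEnd (f : X ⟶ Y) (M : Y.Modules) (u : Γ(Y, ⊤)) :
    (Scheme.Modules.pullback f).map (smulEnd M u) =
      smulEnd ((Scheme.Modules.pullback f).obj M) (f.appTop u) := by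
  let adj := Scheme.Modules.pullbackPushforwardAdjunction f
  apply (adj.homEquiv _ _).injective
  rw [Adjunction.homEquiv_unit, Adjunction.homEquiv_unit]
  refine (adj.unit_naturality (smulEnd M u)).trans ?_
  ext U s
  refine ((adj.unit.app M).app_smul (Y.presheaf.map (homOfLE (le_top : U ≤ ⊤)).op u) s).trans ?_
  let t : Γ((Scheme.Modules.pullback f).obj M, f ⁻¹ᵁ U) := (adj.unit.app M).app U s
  change f.app U (Y.presheaf.map (homOfLE (le_top : U ≤ ⊤)).op u) • t =
    (_ : Γ(X, f ⁻¹ᵁ U)) • t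
  congr 1
  exact congr($(f.naturality (homOfLE (le_top : U ≤ ⊤)).op) u)

/-- The structure sheaf as a module over itself. -/
abbrev structureModule (X : Scheme.{u}) : X.Modules := SheafOfModules.unit X.ringCatSheaf

/-- The section `1` of the structure sheaf. -/
def oneSection (U : X.Opens) : Γ(structureModule X, U) := (1 : Γ(X, U))

lemma smul_oneSection (U : X.Opens) (r : Γ(X, U)) : r • oneSection U = r := mul_one r

lemma structureModule_hom_ext {M : X.Modules} {A B : structureModule X ⟶ M}
    (h : A.app ⊤ (oneSection ⊤) = B.app ⊤ (oneSection ⊤)) : A = B := by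
  have happ (C : structureModule X ⟶ M) (U : X.Opens) : C.app U (oneSection U) =
      M.presheaf.map (homOfLE (le_top : U ≤ ⊤)).op (C.app ⊤ (oneSection ⊤)) :=
    (congrArg (C.app U) (map_one (X.presheaf.map (homOfLE (le_top : U ≤ ⊤)).op).hom).symm).trans
      congr($(C.mapPresheaf.naturality (homOfLE (le_top : U ≤ ⊤)).op) (oneSection ⊤))
  refine Scheme.Modules.hom_ext _ _ fun U => ?_
  ext (r : Γ(X, U))
  rw [← smul_oneSection U r, Scheme.Modules.Hom.app_smul, Scheme.Modules.Hom.app_smul, happ A,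
    happ B, h]

lemma smulEnd_structureModule_bijective :
    Function.Bijective (smulEnd (structureModule X)) := by
  refine ⟨fun u v h => ?_, fun A => ?_⟩
  · have h := congr(Scheme.Modules.Hom.app $h ⊤ (oneSection ⊤))
    rwa [smulEnd_app_top, smulEnd_app_top, smul_oneSection, smul_oneSection] at h
  · obtain ⟨u, hu⟩ : ∃ u : Γ(X, ⊤), A.app ⊤ (oneSection ⊤) = u • oneSection ⊤ :=
      ⟨_, (smul_oneSection _ _).symm⟩
    refine ⟨u, structureModule_hom_ext ?_⟩
    rw [smulEnd_app_top, hu]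

lemma smulEnd_bijective {M : X.Modules} (e : M ≅ structureModule X) :
    Function.Bijective (smulEnd M) := by
  have h : ⇑e.conj ∘ smulEnd M = smulEnd (structureModule X) :=
    funext (conj_smulEnd e)
  rw [← e.conj.bijective.of_comp_iff', h]
  exact smulEnd_structureModule_bijective

lemma eq_smulEnd_iff {M : X.Modules} (e : M ≅ structureModule X) (A : M ⟶ M) (u : Γ(X, ⊤)) :
    A = smulEnd M u ↔ ∀ s : Γ(M, ⊤), A.app ⊤ s = u • s := by
  refine ⟨fun h s => by rw [h, smulEnd_app_top], fun h => ?_⟩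
  rw [← cancel_epi e.inv]
  refine structureModule_hom_ext ?_
  rw [Scheme.Modules.Hom.comp_app, Scheme.Modules.Hom.comp_app, comp_apply, comp_apply, h,
    smulEnd_app_top]

instance final_opensMap (f : X ⟶ Y) : (TopologicalSpace.Opens.map f.base).Final where
  out V := by
    have h : Limits.IsTerminal (StructuredArrow.mk
        (homOfLE le_top : V ⟶ (TopologicalSpace.Opens.map f.base).obj ⊤)) :=
      Limits.IsTerminal.ofUniqueHom (fun A => StructuredArrow.homMk (homOfLE le_top) rfl)
        (fun A m => by ext; exact Subsingleton.elim _ _)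
    have := h.hasTerminal
    exact isConnected_of_hasTerminal _

/-- The pullback of the structure sheaf is the structure sheaf. -/
def pullbackStructureModuleIso (f : X ⟶ Y) :
    (Scheme.Modules.pullback f).obj (structureModule Y) ≅ structureModule X :=
  haveI : (SheafOfModules.pushforward f.toRingCatSheafHom).IsRightAdjoint :=
    inferInstanceAs ((Scheme.Modules.pushforward f).IsRightAdjoint)
  haveI : IsIso (SheafOfModules.pullbackObjUnitToUnit f.toRingCatSheafHom) :=
    SheafOfModules.instIsIsoPullbackObjUnitToUnitOfFinal _
  let e := asIso (SheafOfModules.pullbackObjUnitToUnit f.toRingCatSheafHom)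
  ⟨e.hom, e.inv, e.hom_inv_id, e.inv_hom_id⟩

lemma IsLineBundle.nonempty_pullback_iso {Y : Scheme.{0}} {L : Y.Modules} (hL : IsLineBundle L)
    {R : CommRingCat.{0}} [IsLocalRing R] (f : Spec R ⟶ Y) :
    Nonempty ((Scheme.Modules.pullback f).obj L ≅ structureModule (Spec R)) := by
  obtain ⟨U, hU, ⟨e⟩⟩ := hL (f (IsLocalRing.closedPoint R))
  have hr : Set.range f ⊆ Set.range U.ι := by
    rintro _ ⟨p, rfl⟩
    rw [Scheme.Opens.range_ι]
    exact ((IsLocalRing.specializes_closedPoint p).map f.continuous).mem_open U.isOpen hU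
  let g := IsOpenImmersion.lift U.ι f hr
  let e' : (Scheme.Modules.restrictFunctor U.ι).obj L ≅ structureModule U.toScheme :=
    ⟨e.hom, e.inv, e.hom_inv_id, e.inv_hom_id⟩
  rw [← IsOpenImmersion.lift_fac U.ι f hr]
  exact ⟨((Scheme.Modules.pullbackComp g U.ι).app L).symm ≪≫
    (Scheme.Modules.pullback g).mapIso
      (((Scheme.Modules.restrictFunctorIsoPullback U.ι).app L).symm ≪≫ e') ≪≫
    pullbackStructureModuleIso g⟩

end Modules

section Laurent

open LaurentPolynomial

lemma exists_eq_C_mul_T_of_isUnit {R : Type*} [CommRing R] [IsDomain R] {u : R[T;T⁻¹]}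
    (hu : IsUnit u) : ∃ (a : R) (n : ℤ), u = C a * T n := by
  obtain ⟨v, huv⟩ := hu.exists_right_inv
  obtain ⟨n, p, hp⟩ := exists_T_pow u
  obtain ⟨m, q, hq⟩ := exists_T_pow v
  have hpq : p * q = Polynomial.X ^ (n + m) := by
    apply Polynomial.toLaurent_injective
    calc (p * q).toLaurent = u * v * (T n * T m) := by rw [map_mul, hp, hq]; ring
      _ = Polynomial.toLaurent (Polynomial.X ^ (n + m)) := by
        rw [huv, one_mul, ← T_add, Polynomial.toLaurent_X_pow, Nat.cast_add]
  obtain ⟨i, -, hi⟩ := (dvd_prime_pow Polynomial.prime_X _).1 (Dvd.intro _ hpq)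
  obtain ⟨w, rfl⟩ := hi.symm
  obtain ⟨a, -, ha⟩ := Polynomial.isUnit_iff.1 w.isUnit
  refine ⟨a, i - n, ?_⟩
  calc u = u * T n * T (-n) := by rw [mul_T_assoc, add_neg_cancel, T_zero, mul_one]
    _ = T i * C a * T (-n) := by
      rw [← hp, ← ha, map_mul, Polynomial.toLaurent_X_pow, Polynomial.toLaurent_C]
    _ = C a * T (i - n) := by rw [T_mul, mul_T_assoc, sub_eq_add_neg]

/-- Units of an `R`-algebra `A` are the algebra maps `R[T;T⁻¹] → A`, with the convolution product:
`x` corresponds to `T ↦ x`. -/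
def laurentUnitsEquiv (R A : Type*) [CommSemiring R] [CommSemiring A] [Algebra R A] :
    Aˣ ≃* WithConv (R[T;T⁻¹] →ₐ[R] A) :=
  (zpowersMulHom Aˣ).trans
    (MonoidHom.toHomUnitsMulEquiv.symm.trans (AddMonoidAlgebra.liftMulEquiv R A ℤ))

variable {R A : Type*} [CommSemiring R] [CommSemiring A] [Algebra R A]

lemma laurentUnitsEquiv_C_mul_T (x : Aˣ) (a : R) (n : ℤ) :
    (laurentUnitsEquiv R A x).ofConv (C a * T n) = algebraMap R A a * (x ^ n : Aˣ) := by
  rw [← single_eq_C_mul_T]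
  exact (AddMonoidAlgebra.lift_single _ _ _).trans (Algebra.smul_def _ _)

lemma laurentUnitsEquiv_C (x : Aˣ) (a : R) :
    (laurentUnitsEquiv R A x).ofConv (C a) = algebraMap R A a := by
  simpa using laurentUnitsEquiv_C_mul_T x a 0

lemma laurentUnitsEquiv_T (x : Aˣ) (n : ℤ) :
    (laurentUnitsEquiv R A x).ofConv (T n) = (x ^ n : Aˣ) := by
  simpa using laurentUnitsEquiv_C_mul_T (R := R) x 1 n

lemma laurent_algHom_ext {f g : R[T;T⁻¹] →ₐ[R] A} (h : f (T 1) = g (T 1)) : f = g := by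
  obtain ⟨x, hx⟩ := (laurentUnitsEquiv R A).surjective (WithConv.toConv f)
  obtain ⟨y, hy⟩ := (laurentUnitsEquiv R A).surjective (WithConv.toConv g)
  obtain rfl : x = y := Units.ext <| by
    rw [← WithConv.ofConv_toConv f, ← WithConv.ofConv_toConv g, ← hx, ← hy] at h
    simpa only [laurentUnitsEquiv_T, zpow_one] using h
  exact WithConv.toConv_injective (hx.symm.trans hy)

end Laurent

section MultiplicativeGroup

variable {A : Type} [CommRing A] [Algebra ℂ A]

/-- `Gm` represents the functor of units. -/
def Gm.unitsEquiv (A : Type) [CommRing A] [Algebra ℂ A] :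
    Aˣ ≃* ((Spec (.of A)).asOver SpecC ⟶ Gm) :=
  (laurentUnitsEquiv ℂ A).trans (Spec.mapMulEquiv (R := ℂ) (S := ℂ[T;T⁻¹]) (T := A))

lemma Gm.unitsEquiv_left (x : Aˣ) : (Gm.unitsEquiv A x).left =
    Spec.map (CommRingCat.ofHom (laurentUnitsEquiv ℂ A x).ofConv.toRingHom) := rfl

lemma Gm.unitsEquiv_T :
    Gm.unitsEquiv ℂ[T;T⁻¹] (LaurentPolynomial.isUnit_T 1).unit = 𝟙 Gm := by
  have h : (laurentUnitsEquiv ℂ ℂ[T;T⁻¹] (LaurentPolynomial.isUnit_T 1).unit).ofConv =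
      AlgHom.id ℂ ℂ[T;T⁻¹] := laurent_algHom_ext <| by
    rw [laurentUnitsEquiv_T, zpow_one, IsUnit.unit_spec, AlgHom.id_apply]
  ext1
  rw [Gm.unitsEquiv_left, h]
  exact Spec.map_id _

lemma Gm.toUnit_comp_point (z : ℂˣ) : toUnit ((Spec (.of A)).asOver SpecC) ≫ Gm.point z =
    Gm.unitsEquiv A (Units.map (algebraMap ℂ A) z) := by
  have h : (laurentUnitsEquiv ℂ A (Units.map (algebraMap ℂ A) z)).ofConv =
      (Algebra.ofId ℂ A).comp (laurentUnitsEquiv ℂ ℂ z).ofConv := laurent_algHom_ext <| by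
    rw [AlgHom.comp_apply, laurentUnitsEquiv_T, laurentUnitsEquiv_T, zpow_one, zpow_one]
    rfl
  have hz : (LaurentPolynomial.eval₂ (RingHom.id ℂ) z) = (laurentUnitsEquiv ℂ ℂ z).ofConv := by
    ext <;> simp [laurentUnitsEquiv_C, laurentUnitsEquiv_T]
  ext1
  refine (Spec.map_comp _ _).symm.trans ?_
  rw [← CommRingCat.ofHom_comp, Gm.unitsEquiv_left, h, hz]
  rfl

lemma Gm.point_surjective : Function.Surjective Gm.point := fun p => by
  obtain ⟨z, hz⟩ := (Gm.unitsEquiv ℂ).surjective (toUnit ((Spec (.of ℂ)).asOver SpecC) ≫ p)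
  let s : 𝟙_ SchC ⟶ (Spec (.of ℂ)).asOver SpecC := Over.homMk (𝟙 SpecC) (Spec.map_id _)
  have hs : s ≫ toUnit ((Spec (.of ℂ)).asOver SpecC) = 𝟙 _ := toUnit_unique _ _
  refine ⟨z, ?_⟩
  have hz' := (Gm.toUnit_comp_point (A := ℂ) z).trans hz
  calc Gm.point z = s ≫ toUnit ((Spec (.of ℂ)).asOver SpecC) ≫ Gm.point z := by
        rw [← Category.assoc, hs, Category.id_comp]
    _ = p := by rw [hz', ← Category.assoc, hs, Category.id_comp]

lemma Gm.toUnit_comp_point_mul_id (z : ℂˣ) : (toUnit Gm ≫ Gm.point z) * 𝟙 Gm =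
    Gm.unitsEquiv ℂ[T;T⁻¹] (Units.map (algebraMap ℂ ℂ[T;T⁻¹]) z *
      (LaurentPolynomial.isUnit_T 1).unit) := by
  rw [map_mul, Gm.unitsEquiv_T, ← Gm.toUnit_comp_point]

lemma Gm.point_one : Gm.point 1 = 1 := by
  have h : toUnit Gm ≫ Gm.point 1 = 1 := by
    rw [Gm.toUnit_comp_point, map_one, map_one]
  calc Gm.point 1 = Gm.point 1 ≫ toUnit Gm ≫ Gm.point 1 := by
        rw [← Category.assoc, toUnit_unique (Gm.point 1 ≫ toUnit Gm) (𝟙 _), Category.id_comp]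
    _ = 1 := by rw [h, MonObj.comp_one]

/-- Multiplication by `a` on the affine line. -/
def A1.scale (a : ℂ) : A1 ⟶ A1 :=
  (Spec.map (CommRingCat.ofHom
    (Polynomial.aeval (Polynomial.C a * Polynomial.X) : ℂ[X] →ₐ[ℂ] ℂ[X]).toRingHom)).asOver SpecC

lemma A1.zero_comp_scale (a : ℂ) : A1.zero ≫ A1.scale a = A1.zero := by
  ext1
  refine (Spec.map_comp _ _).symm.trans ?_
  rw [← CommRingCat.ofHom_comp]
  exact congrArg (fun φ => Spec.map (CommRingCat.ofHom φ)) (by ext <;> simp)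

lemma Gm.unitsEquiv_comp_inv_left (x : Aˣ) : (Gm.unitsEquiv A x ≫ Gm.inv).left =
    Spec.map (CommRingCat.ofHom (Polynomial.aeval (R := ℂ) (x⁻¹ : Aˣ).val).toRingHom) := by
  refine (Spec.map_comp _ _).symm.trans ?_
  rw [← CommRingCat.ofHom_comp]
  refine congrArg (fun φ => Spec.map (CommRingCat.ofHom φ))
    (Polynomial.ringHom_ext (fun a => ?_) ?_)
  · refine (congrArg (laurentUnitsEquiv ℂ A x).ofConv (Polynomial.eval₂_C _ _)).trans ?_
    exact (laurentUnitsEquiv_C x a).trans (Polynomial.aeval_C _ a).symm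
  · refine (congrArg (laurentUnitsEquiv ℂ A x).ofConv (Polynomial.eval₂_X _ _)).trans ?_
    rw [laurentUnitsEquiv_T, zpow_neg_one]
    exact (Polynomial.aeval_X _).symm

lemma Gm.inv_comp_scale (z : ℂˣ) : Gm.inv ≫ A1.scale (z⁻¹ : ℂˣ) =
    ((toUnit Gm ≫ Gm.point z) * 𝟙 Gm) ≫ Gm.inv := by
  have hT : ((LaurentPolynomial.isUnit_T (R := ℂ) 1).unit⁻¹ : ℂ[T;T⁻¹]ˣ).val =
      LaurentPolynomial.T (-1) := Units.inv_eq_of_mul_eq_one_right <| by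
    rw [IsUnit.unit_spec, ← LaurentPolynomial.T_add, add_neg_cancel, LaurentPolynomial.T_zero]
  rw [Gm.toUnit_comp_point_mul_id]
  ext1
  rw [Gm.unitsEquiv_comp_inv_left, mul_inv, ← map_inv, Units.val_mul, hT]
  refine (Spec.map_comp _ _).symm.trans ?_
  rw [← CommRingCat.ofHom_comp]
  refine congrArg (fun φ => Spec.map (CommRingCat.ofHom φ))
    (Polynomial.ringHom_ext (fun a => ?_) ?_)
  · simp [LaurentPolynomial.algebraMap_apply]
  · simp [LaurentPolynomial.algebraMap_apply]

end MultiplicativeGroup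

section Projective

attribute [local instance] MvPolynomial.gradedAlgebra

lemma isProper_projToSpec (n : ℕ) : IsProper (projToSpec n) := by
  let 𝒜 := MvPolynomial.homogeneousSubmodule (Fin (n + 1)) ℂ
  have finiteType : Algebra.FiniteType (𝒜 0) (MvPolynomial (Fin (n + 1)) ℂ) :=
    have : IsScalarTower ℂ (𝒜 0) (MvPolynomial (Fin (n + 1)) ℂ) :=
      IsScalarTower.of_algebraMap_eq (R := ℂ) (S := 𝒜 0) (A := MvPolynomial (Fin (n + 1)) ℂ)
        fun _ => rfl
    Algebra.FiniteType.of_restrictScalars_finiteType ℂ _ _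
  have proper_toSpecZero : IsProper (Proj.toSpecZero 𝒜) := inferInstance
  have isClosedImmersion_zero :
      IsClosedImmersion (Spec.map (CommRingCat.ofHom (algebraMap ℂ (𝒜 0)))) := by
    apply IsClosedImmersion.spec_of_surjective
    rintro ⟨p, hp⟩
    have hp' : p.IsHomogeneous 0 := hp
    refine ⟨p.coeff 0, Subtype.ext ?_⟩
    exact (MvPolynomial.totalDegree_eq_zero_iff_eq_C.1
      (Nat.le_zero.1 hp'.totalDegree_le)).symm
  exact inferInstanceAs (IsProper (_ ≫ _))

lemma IsProjective.isProper {X : SchC} (hX : IsProjective X) : IsProper X.hom := by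
  obtain ⟨n, i, hi, h⟩ := hX
  have := isProper_projToSpec n
  rw [← h]
  infer_instance

end Projective

section Extension

variable {X Y S : Scheme.{u}}

lemma fromFunctionField_eq [IrreducibleSpace X] (f : X.PartialMap Y) {x : X} (hx : x ∈ f.domain) :
    f.fromFunctionField =
      Spec.map (X.presheaf.stalkSpecializes ((genericPoint_spec X).specializes trivial)) ≫
        f.fromSpecStalkOfMem hx := by
  rw [Scheme.PartialMap.fromFunctionField, Scheme.PartialMap.fromSpecStalkOfMem,
    Scheme.PartialMap.fromSpecStalkOfMem, ← Category.assoc]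
  congr 1
  rw [← cancel_mono f.domain.ι, Category.assoc, Scheme.Opens.fromSpecStalkOfMem_ι,
    Scheme.Opens.fromSpecStalkOfMem_ι, Scheme.SpecMap_stalkSpecializes_fromSpecStalk]

lemma exists_lift_of_valuationRing (sY : Y ⟶ S) [UniversallyClosed sY] {R K : CommRingCat.{u}}
    [IsDomain R] [ValuationRing R] (hK : IsField K) (φ : R ⟶ K)
    (h : letI := φ.hom.toAlgebra; IsFractionRing R K) (i₁ : Spec K ⟶ Y) (i₂ : Spec R ⟶ S)
    (w : i₁ ≫ sY = Spec.map φ ≫ i₂) : ∃ l : Spec R ⟶ Y, Spec.map φ ≫ l = i₁ ∧ l ≫ sY = i₂ := by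
  have hval : ValuativeCriterion.Existence sY := by
    have : UniversallyClosed sY := inferInstance
    rw [UniversallyClosed.eq_valuativeCriterion] at this
    exact this.1
  let := φ.hom.toAlgebra
  let := hK.toField
  let sq : ValuativeCommSq sY := { R := R, K := K, i₁ := i₁, i₂ := i₂, commSq := ⟨w⟩ }
  obtain ⟨⟨l, hl₁, hl₂⟩⟩ := (hval sq).exists_lift
  exact ⟨l, hl₁, hl₂⟩

lemma mem_domain_of_valuationRing [IsIntegral X] (sX : X ⟶ S) (sY : Y ⟶ S) [UniversallyClosed sY]
    [LocallyOfFiniteType sY] (f : X.PartialMap Y) (hf : f.hom ≫ sY = f.domain.ι ≫ sX) (x : X)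
    [ValuationRing (X.presheaf.stalk x)] : x ∈ f.toRationalMap.domain := by
  have hK : f.fromFunctionField ≫ sY = X.fromSpecStalk (genericPoint X) ≫ sX := by
    rw [Scheme.PartialMap.fromFunctionField, Scheme.PartialMap.fromSpecStalkOfMem, Category.assoc,
      hf, Scheme.Opens.fromSpecStalkOfMem_ι_assoc]
  obtain ⟨φ, hφ₁, hφ₂⟩ := exists_lift_of_valuationRing sY (R := X.presheaf.stalk x)
    (Field.toIsField X.functionField)
    (X.presheaf.stalkSpecializes ((genericPoint_spec X).specializes trivial))
    (inferInstanceAs (IsFractionRing (X.presheaf.stalk x) X.functionField))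
    f.fromFunctionField (X.fromSpecStalk x ≫ sX) (by
      rw [hK, Scheme.SpecMap_stalkSpecializes_fromSpecStalk_assoc])
  let g := Scheme.PartialMap.ofFromSpecStalk sX sY φ hφ₂
  have hg : x ∈ g.domain := Scheme.PartialMap.mem_domain_ofFromSpecStalk sX sY φ hφ₂
  refine Scheme.RationalMap.mem_domain.2 ⟨g, hg, ?_⟩
  apply Scheme.RationalMap.eq_of_fromFunctionField_eq
  rw [Scheme.RationalMap.fromFunctionField_toRationalMap,
    Scheme.RationalMap.fromFunctionField_toRationalMap, fromFunctionField_eq g hg,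
    Scheme.PartialMap.fromSpecStalkOfMem_ofFromSpecStalk]
  exact hφ₁

lemma exists_extension_of_domain_eq_top [IsReduced X] [Y.IsSeparated] (f : X.PartialMap Y)
    (hf : f.toRationalMap.domain = ⊤) : ∃ σ : X ⟶ Y, f.domain.ι ≫ σ = f.hom := by
  have hι : f.domain.ι ≫ X.topIso.inv ≫ X.homOfLE hf.ge =
      X.homOfLE f.le_domain_toRationalMap := by
    rw [← cancel_mono (Scheme.Opens.ι _)]
    simp
  obtain ⟨s, hs⟩ : ∃ s : f.toRationalMap.domain.toScheme ⟶ Y,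
      X.homOfLE f.le_domain_toRationalMap ≫ s = f.hom :=
    ⟨_, f.toPartialMap_toRationalMap_restrict⟩
  exact ⟨X.topIso.inv ≫ X.homOfLE hf.ge ≫ s, by rw [reassoc_of% hι, hs]⟩

lemma exists_extension [IsIntegral X] [∀ x : X, ValuationRing (X.presheaf.stalk x)]
    (sX : X ⟶ S) (sY : Y ⟶ S) [IsProper sY] [S.IsSeparated] {W : Scheme.{u}} (j : W ⟶ X)
    [IsOpenImmersion j] [IsDominant j] (f : W ⟶ Y) (hf : f ≫ sY = j ≫ sX) :
    ∃ σ : X ⟶ Y, j ≫ σ = f ∧ σ ≫ sY = sX := by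
  have : Y.IsSeparated := ⟨by
    rw [← Limits.terminal.comp_from sY]
    infer_instance⟩
  let f₀ : X.PartialMap Y :=
    { domain := j.opensRange
      dense_domain := j.denseRange
      hom := j.isoOpensRange.inv ≫ f }
  have hf₀ : f₀.hom ≫ sY = f₀.domain.ι ≫ sX := by
    change (j.isoOpensRange.inv ≫ f) ≫ sY = j.opensRange.ι ≫ sX
    rw [Category.assoc, hf, ← Category.assoc, Scheme.Hom.isoOpensRange_inv_comp]
  obtain ⟨σ, hσ⟩ := exists_extension_of_domain_eq_top f₀ <|
    top_le_iff.1 fun x _ => mem_domain_of_valuationRing sX sY f₀ hf₀ x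
  have hjσ : j ≫ σ = f := by
    calc j ≫ σ = j.isoOpensRange.hom ≫ f₀.domain.ι ≫ σ := by simp [f₀]
      _ = f := by rw [hσ, Iso.hom_inv_id_assoc]
  refine ⟨σ, hjσ, ?_⟩
  apply ext_of_isDominant j
  rw [reassoc_of% hjσ, hf]

end Extension

section AffineLine

instance valuationRing_stalk {R : CommRingCat.{u}} [IsDedekindDomain R] (p : Spec R) :
    ValuationRing ((Spec R).presheaf.stalk p) := by
  have : p.asIdeal.IsPrime := p.isPrime
  let : Algebra R ((Spec R).presheaf.stalk p) := StructureSheaf.stalkAlgebra R p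
  have : IsLocalization.AtPrime ((Spec R).presheaf.stalk p) p.asIdeal :=
    StructureSheaf.IsLocalization.to_stalk R p
  have : IsDedekindDomain ((Spec R).presheaf.stalk p) :=
    IsLocalization.AtPrime.isDedekindDomain R p.asIdeal _
  infer_instance

/-- The morphism of schemes underlying `Gm.inv`. -/
abbrev invHom : Spec (.of ℂ[T;T⁻¹]) ⟶ Spec (.of ℂ[X]) := Gm.inv.left

instance isOpenImmersion_inv : IsOpenImmersion invHom := by
  let e : ℂ[T;T⁻¹] ≃+* ℂ[T;T⁻¹] := LaurentPolynomial.invert.toRingEquiv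
  have h : invHom = Spec.map e.toCommRingCatIso.hom ≫
      Spec.map (CommRingCat.ofHom (algebraMap ℂ[X] ℂ[T;T⁻¹])) := by
    rw [← Spec.map_comp, RingEquiv.toCommRingCatIso_hom, ← CommRingCat.ofHom_comp]
    refine congrArg (fun φ => Spec.map (CommRingCat.ofHom φ)) ?_
    apply Polynomial.ringHom_ext <;> simp [e]
  have : IsOpenImmersion (Spec.map (CommRingCat.ofHom (algebraMap ℂ[X] ℂ[T;T⁻¹]))) :=
    IsOpenImmersion.of_isLocalization (Polynomial.X : ℂ[X])
  rw [h]
  infer_instance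

instance isDominant_inv : IsDominant invHom :=
  ⟨invHom.opensRange.isOpen.dense ⟨_, Set.mem_range_self (⊥ : PrimeSpectrum ℂ[T;T⁻¹])⟩⟩

lemma exists_inv_comp_eq {X : SchC} [IsProper X.hom] (f : Gm ⟶ X) :
    ∃ σ : A1 ⟶ X, Gm.inv ≫ σ = f := by
  obtain ⟨σ, hσ, hσ'⟩ := exists_extension (X := Spec (.of ℂ[X])) A1.hom X.hom invHom f.left
    ((Over.w f).trans (Over.w Gm.inv).symm)
  exact ⟨Over.homMk σ hσ', by ext1; exact hσ⟩

lemma eq_of_inv_comp_eq {X : SchC} [IsSeparated X.hom] {σ τ : A1 ⟶ X}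
    (h : Gm.inv ≫ σ = Gm.inv ≫ τ) : σ = τ := by
  ext1
  exact ext_of_isDominant_of_isSeparated (X := Spec (.of ℂ[X])) X.hom
    ((Over.w σ).trans (Over.w τ).symm) invHom congr(($h).left)

end AffineLine

section Points

instance locallyOfFiniteType_Gm : LocallyOfFiniteType Gm.hom :=
  locallyOfFiniteType_specOverSpec (R := .of ℂ) (A := .of ℂ[T;T⁻¹])

instance isReduced_Gm : IsReduced Gm.left := inferInstanceAs (IsReduced (Spec (.of ℂ[T;T⁻¹])))

lemma hom_ext_of_points {Z X : SchC} [IsReduced Z.left] [LocallyOfFiniteType Z.hom]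
    [IsSeparated X.hom] {f g : Z ⟶ X} (h : ∀ z : Points Z, z ≫ f = z ≫ g) :
    f = g := by
  have : JacobsonSpace Z.left := LocallyOfFiniteType.jacobsonSpace Z.hom
  ext1
  refine ext_of_fromSpecResidueField_eq f.left g.left X.hom (closedPoints Z.left)
    (dense_iff_closure_eq.2 closure_closedPoints) (fun p hp => ?_)
    ((Over.w f).trans (Over.w g).symm)
  rw [← cancel_epi (Spec.map (residueFieldIsoBase (K := ℂ) Z.hom p hp).hom), ← Category.assoc,
    ← Category.assoc]
  let z : Points Z := Over.homMk (pointOfClosedPoint (K := ℂ) Z.hom p hp)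
    (pointOfClosedPoint_comp (K := ℂ) Z.hom p hp)
  exact congr(($(h z)).left)

end Points

section Limits

variable {G : SchC} [GrpObj G] {X : SchC} [ModObj G X]

lemma comp_toUnit_comp {Z : SchC} (z : Points Z) (y : Points X) : z ≫ toUnit Z ≫ y = y := by
  rw [← Category.assoc, toUnit_unique (z ≫ toUnit Z) (𝟙 _), Category.id_comp]

lemma IsLimit.unique [IsSeparated X.hom] {l : Gm ⟶ G} {x y y' : Points X}
    (h : IsLimit l x y) (h' : IsLimit l x y') : y = y' := by
  obtain ⟨σ, hσ, rfl⟩ := h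
  obtain ⟨τ, hτ, rfl⟩ := h'
  rw [eq_of_inv_comp_eq (hσ.trans hτ.symm)]

lemma exists_isLimit [IsProper X.hom] (l : Gm ⟶ G) (x : Points X) : ∃ y, IsLimit l x y := by
  obtain ⟨σ, hσ⟩ := exists_inv_comp_eq (l • (toUnit Gm ≫ x))
  exact ⟨_, σ, hσ, rfl⟩

lemma IsLimit.comp {Y : SchC} [ModObj G Y] (π : X ⟶ Y) [IsModHom G π] {l : Gm ⟶ G}
    {x y : Points X} (h : IsLimit l x y) : IsLimit l (x ≫ π) (y ≫ π) := by
  obtain ⟨σ, hσ, rfl⟩ := h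
  refine ⟨σ ≫ π, ?_, by rw [Category.assoc]⟩
  rw [reassoc_of% hσ, IsModHom.map_smul, Category.assoc]

lemma toUnit_point_smul_eq_scale_comp [IsSeparated X.hom] {l : Gm ⟶ G} [IsMonHom l] {x : Points X}
    {σ : A1 ⟶ X} (hσ : Gm.inv ≫ σ = l • (toUnit Gm ≫ x)) (z : ℂˣ) :
    (toUnit A1 ≫ Gm.point z ≫ l) • σ = A1.scale (z⁻¹ : ℂˣ) ≫ σ := by
  apply eq_of_inv_comp_eq
  set t : Gm ⟶ Gm := (toUnit Gm ≫ Gm.point z) * 𝟙 Gm with ht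
  have hl : Gm.inv ≫ toUnit A1 ≫ Gm.point z ≫ l = (toUnit Gm ≫ Gm.point z) ≫ l := by
    rw [← Category.assoc, toUnit_unique (Gm.inv ≫ toUnit A1) (toUnit Gm), Category.assoc]
  calc Gm.inv ≫ ((toUnit A1 ≫ Gm.point z ≫ l) • σ)
      = (((toUnit Gm ≫ Gm.point z) ≫ l) * l) • (toUnit Gm ≫ x) := by
        rw [ModObj.comp_smul, hσ, hl, mul_smul]
    _ = (t ≫ l) • (t ≫ toUnit Gm ≫ x) := by
        rw [ht, MonObj.mul_comp, Category.id_comp, ← ht, ← Category.assoc t,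
          toUnit_unique (t ≫ toUnit Gm) (toUnit Gm)]
    _ = Gm.inv ≫ A1.scale (z⁻¹ : ℂˣ) ≫ σ := by
        rw [← ModObj.comp_smul, ← hσ, ← Category.assoc Gm.inv, Gm.inv_comp_scale, Category.assoc]

lemma IsLimit.point_smul [IsSeparated X.hom] {l : Gm ⟶ G} [IsMonHom l] {x y : Points X}
    (h : IsLimit l x y) (z : ℂˣ) : (Gm.point z ≫ l) • y = y := by
  obtain ⟨σ, hσ, rfl⟩ := h
  calc (Gm.point z ≫ l) • (A1.zero ≫ σ)
      = A1.zero ≫ ((toUnit A1 ≫ Gm.point z ≫ l) • σ) := by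
        rw [ModObj.comp_smul, comp_toUnit_comp]
    _ = A1.zero ≫ σ := by
        rw [toUnit_point_smul_eq_scale_comp hσ, ← Category.assoc, A1.zero_comp_scale]

lemma IsLimit.smul_toUnit_comp [IsSeparated X.hom] {l : Gm ⟶ G} [IsMonHom l] {x y : Points X}
    (h : IsLimit l x y) : l • (toUnit Gm ≫ y) = toUnit Gm ≫ y := by
  refine hom_ext_of_points fun p => ?_
  obtain ⟨z, rfl⟩ := Gm.point_surjective p
  rw [ModObj.comp_smul, comp_toUnit_comp, h.point_smul]

end Limits

section Linearization

variable {G : SchC} [GrpObj G] {X : SchC} [ModObj G X] {L : X.left.Modules}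

/-- The `T`-point `g` of `G` fixes the `T`-point `x` of `X`, and acts on `x^* L` as multiplication
by the function `u` on `T`. -/
def Linearization.ActsBy (Φ : Linearization G L) {T : SchC} (g : T ⟶ G) (x : T ⟶ X)
    (u : Γ(T.left, ⊤)) : Prop :=
  ∃ h : g • x = x, (Φ.act g x x h).hom = smulEnd _ u

variable {Φ : Linearization G L} {T : SchC} {g : T ⟶ G} {x : T ⟶ X}

lemma Linearization.actsBy_one (Φ : Linearization G L) (x : T ⟶ X) : Φ.ActsBy 1 x 1 := by
  have h : (1 : T ⟶ G) • x = x := one_smul _ x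
  refine ⟨h, ?_⟩
  have hmul : Φ.act 1 x x h = Φ.act 1 x x h ≪≫ Φ.act 1 x x h := by
    rw [← Φ.act_mul 1 1 x x x h h (by rw [mul_one, h])]
    congr 1
    exact (mul_one 1).symm
  rw [map_one, End.one_def, ← cancel_epi (Φ.act 1 x x h).hom, Category.comp_id]
  exact congr(($hmul).hom).symm

lemma Linearization.ActsBy.comp {u : Γ(T.left, ⊤)} (hu : Φ.ActsBy g x u) {T' : SchC}
    (f : T' ⟶ T) : Φ.ActsBy (f ≫ g) (f ≫ x) (f.left.appTop u) := by
  obtain ⟨h, hu⟩ := hu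
  have h' : (f ≫ g) • (f ≫ x) = f ≫ x := by rw [← ModObj.comp_smul, h]
  have hact := Φ.act_comp f g x x h h'
  rw [hu, pullback_map_smulEnd, smulEnd_comp, cancel_epi] at hact
  exact ⟨h', hact.symm⟩

lemma Linearization.ActsBy.unique {u v : Γ(T.left, ⊤)} (hu : Φ.ActsBy g x u)
    (hv : Φ.ActsBy g x v) (e : (Scheme.Modules.pullback x.left).obj L ≅ structureModule T.left) :
    u = v := by
  obtain ⟨h, hu⟩ := hu
  obtain ⟨_, hv⟩ := hv
  exact (smulEnd_bijective e).injective (hu.symm.trans hv)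

lemma Linearization.exists_isUnit_actsBy (Φ : Linearization G L) (h : g • x = x)
    (e : (Scheme.Modules.pullback x.left).obj L ≅ structureModule T.left) :
    ∃ u, IsUnit u ∧ Φ.ActsBy g x u := by
  obtain ⟨u, hu⟩ := (smulEnd_bijective e).surjective (Φ.act g x x h).hom
  refine ⟨u, ?_, h, hu.symm⟩
  rw [← MulEquiv.isUnit_map (RingEquiv.ofBijective _ (smulEnd_bijective e)),
    RingEquiv.ofBijective_apply, hu, isUnit_iff_isIso]
  infer_instance

lemma Linearization.ActsBy.pullback {Y : SchC} [ModObj G Y] {L : Y.left.Modules}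
    {Φ : Linearization G L} (π : X ⟶ Y) [IsModHom G π] (h : g • x = x) {u : Γ(T.left, ⊤)}
    (hu : Φ.ActsBy g (x ≫ π) u) : (Φ.pullback π).ActsBy g x u := by
  obtain ⟨h', hu⟩ := hu
  let e := (Scheme.Modules.pullbackComp x.left π.left).app L
  refine ⟨h, ?_⟩
  calc ((Φ.pullback π).act g x x h).hom
      = e.hom ≫ (Φ.act g (x ≫ π) (x ≫ π) h').hom ≫ e.inv := rfl
    _ = smulEnd _ u := by
      rw [hu]
      exact conj_smulEnd e.symm u

end Linearization

section Weight

variable {G : SchC} [GrpObj G] {X : SchC} [ModObj G X] {L : X.left.Modules}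
  {Φ : Linearization G L} {l : Gm ⟶ G} {x y : Points X}

lemma hasWeight_iff (e : fibreSheaf L y ≅ structureModule SpecC) {c : ℤ} :
    HasWeight Φ l y c ↔ ∀ z, Φ.ActsBy (Gm.point z ≫ l) y (scalar ((z ^ c : ℂˣ) : ℂ)) :=
  forall_congr' fun _ => exists_congr fun _ => (eq_smulEnd_iff e _ _).symm

lemma scalar_injective : Function.Injective scalar :=
  ((Scheme.ΓSpecIso (.of ℂ)).commRingCatIsoToRingEquiv.symm.injective :)

lemma Gm.point_appTop (z : ℂˣ) (a : ℂ) (c : ℤ) :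
    (Scheme.Hom.appTop (X := SpecC) (Gm.point z).left) ((Scheme.ΓSpecIso (.of ℂ[T;T⁻¹])).inv
      (LaurentPolynomial.C a * LaurentPolynomial.T c)) = scalar (a * (z ^ c : ℂˣ)) := by
  have hz : LaurentPolynomial.eval₂ (RingHom.id ℂ) z
      (LaurentPolynomial.C a * LaurentPolynomial.T c) = a * (z ^ c : ℂˣ) :=
    LaurentPolynomial.eval₂_C_mul_T ..
  rw [← hz]
  exact congr($(Scheme.ΓSpecIso_inv_naturality
    (CommRingCat.ofHom (LaurentPolynomial.eval₂ (RingHom.id ℂ) z))) _).symm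

lemma Gm.exists_eq_C_mul_T_of_isUnit {u : Γ(Gm.left, ⊤)} (hu : IsUnit u) :
    ∃ (a : ℂ) (c : ℤ), u = (Scheme.ΓSpecIso (.of ℂ[T;T⁻¹])).inv
      (LaurentPolynomial.C a * LaurentPolynomial.T c) := by
  obtain ⟨a, c, hac⟩ :=
    GIT.exists_eq_C_mul_T_of_isUnit (hu.map (Scheme.ΓSpecIso (.of ℂ[T;T⁻¹])).hom.hom)
  refine ⟨a, c, ?_⟩
  rw [← hac]
  exact congr($((Scheme.ΓSpecIso (.of ℂ[T;T⁻¹])).hom_inv_id) u).symm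

lemma exists_hasWeight [IsMonHom l] (Φ : Linearization G L)
    (hy : l • (toUnit Gm ≫ y) = toUnit Gm ≫ y) (e : fibreSheaf L y ≅ structureModule SpecC) :
    ∃ c, HasWeight Φ l y c := by
  let e' : (Scheme.Modules.pullback (toUnit Gm ≫ y).left).obj L ≅ structureModule Gm.left :=
    ((Scheme.Modules.pullbackComp (toUnit Gm).left y.left).app L).symm ≪≫
      (Scheme.Modules.pullback (toUnit Gm).left).mapIso e ≪≫
      pullbackStructureModuleIso (toUnit Gm).left
  obtain ⟨u, hu, hact⟩ := Φ.exists_isUnit_actsBy hy e'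
  obtain ⟨a, c, rfl⟩ := Gm.exists_eq_C_mul_T_of_isUnit hu
  have hpoint (z : ℂˣ) : Φ.ActsBy (Gm.point z ≫ l) y (scalar (a * (z ^ c : ℂˣ))) := by
    have hz := hact.comp (Gm.point z)
    rwa [comp_toUnit_comp, Gm.point_appTop] at hz
  have ha : a = 1 := by
    have hone := hpoint 1
    rw [Gm.point_one, MonObj.one_comp, one_zpow, Units.val_one, mul_one] at hone
    refine scalar_injective ((hone.unique (Φ.actsBy_one y) e).trans ?_)
    exact (map_one (Scheme.ΓSpecIso (.of ℂ)).inv.hom).symm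
  refine ⟨c, (hasWeight_iff e).2 fun z => ?_⟩
  simpa only [ha, one_mul] using hpoint z

lemma HasWeight.unique {c c' : ℤ} (h : HasWeight Φ l y c) (h' : HasWeight Φ l y c')
    (e : fibreSheaf L y ≅ structureModule SpecC) : c = c' := by
  have hscalar (z : ℂˣ) : z ^ c = z ^ c' := Units.ext <| scalar_injective <|
    ((hasWeight_iff e).1 h z).unique ((hasWeight_iff e).1 h' z) e
  have h2 : (2 : ℂ) ^ c = 2 ^ c' := by
    simpa using congrArg Units.val (hscalar (Units.mk0 2 two_ne_zero))
  refine zpow_right_injective₀ (a := (2 : ℝ)) two_pos (by norm_num)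
    (Complex.ofReal_injective ?_)
  push_cast
  exact h2

lemma HasWeight.pullback {Y : SchC} [ModObj G Y] {L : Y.left.Modules} {Φ : Linearization G L}
    (π : X ⟶ Y) [IsModHom G π] {c : ℤ} (h : HasWeight Φ l (y ≫ π) c)
    (hy : ∀ z, (Gm.point z ≫ l) • y = y) (e : fibreSheaf L (y ≫ π) ≅ structureModule SpecC) :
    HasWeight (Φ.pullback π) l y c :=
  (hasWeight_iff ((Scheme.Modules.pullbackComp y.left π.left).app L ≪≫ e)).2 fun z =>
    ((hasWeight_iff e).1 h z).pullback π (hy z)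

lemma hasMu_iff [IsSeparated X.hom] (hlim : IsLimit l x y) {c : ℤ} (hc : HasWeight Φ l y c)
    (e : fibreSheaf L y ≅ structureModule SpecC) {m : ℤ} : HasMu Φ l x m ↔ m = -c := by
  constructor
  · rintro ⟨y', c', hlim', hc', rfl⟩
    obtain rfl := hlim.unique hlim'
    rw [hc.unique hc' e]
  · rintro rfl
    exact ⟨y, c, hlim, hc, rfl⟩

lemma existsUnique_hasMu [IsSeparated X.hom] (hlim : IsLimit l x y) {c : ℤ}
    (hc : HasWeight Φ l y c) (e : fibreSheaf L y ≅ structureModule SpecC) :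
    ∃! m, HasMu Φ l x m :=
  ⟨-c, (hasMu_iff hlim hc e).2 rfl, fun _ => (hasMu_iff hlim hc e).1⟩

lemma mu_eq [IsSeparated X.hom] (hlim : IsLimit l x y) {c : ℤ} (hc : HasWeight Φ l y c)
    (e : fibreSheaf L y ≅ structureModule SpecC) : mu Φ l x = -c :=
  (hasMu_iff hlim hc e).1 (Classical.epsilon_spec (existsUnique_hasMu hlim hc e).exists)

end Weight

end GIT

end

theorem mainTheorem11_general {G : GIT.SchC} [GrpObj G] {X Y : GIT.SchC} [ModObj G X]
    [ModObj G Y] [IsProper X.hom] [IsSeparated Y.hom] (π : X ⟶ Y) [IsModHom G π]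
    {L : Y.left.Modules} (hL : GIT.IsLineBundle L) (Φ : GIT.Linearization G L)
    (x : GIT.Points X) (l : GIT.Gm ⟶ G) [IsMonHom l] :
    (∃! m : ℤ, GIT.HasMu (Φ.pullback π) l x m) ∧
    (∃! m : ℤ, GIT.HasMu Φ l (x ≫ π) m) ∧
    GIT.mu (Φ.pullback π) l x = GIT.mu Φ l (x ≫ π) := by
  obtain ⟨y, hy⟩ := GIT.exists_isLimit l x
  have hyπ : GIT.IsLimit l (x ≫ π) (y ≫ π) := hy.comp π
  obtain ⟨e⟩ := hL.nonempty_pullback_iso (y ≫ π).left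
  let eX := (Scheme.Modules.pullbackComp y.left π.left).app L ≪≫ e
  obtain ⟨c, hc⟩ := GIT.exists_hasWeight Φ hyπ.smul_toUnit_comp e
  have hcX : GIT.HasWeight (Φ.pullback π) l y c := hc.pullback π hy.point_smul e
  refine ⟨GIT.existsUnique_hasMu hy hcX eX, GIT.existsUnique_hasMu hyπ hc e, ?_⟩
  rw [GIT.mu_eq hy hcX eX, GIT.mu_eq hyπ hc e]

theorem mainTheorem11 (G : GIT.SchC) [GrpObj G] (hG : GIT.IsReductive G)
    (X Y : GIT.SchC) [ModObj G X] [ModObj G Y]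
    (hX : GIT.IsProjective X) (hY : GIT.IsProjective Y)
    (π : X ⟶ Y) [IsModHom G π] (hπ : IsFinite π.left)
    (L : Y.left.Modules) (hL : GIT.IsAmple L) (Φ : GIT.Linearization G L)
    (x : GIT.Points X) (l : GIT.Gm ⟶ G) [IsMonHom l] :
    (∃! m : ℤ, GIT.HasMu (Φ.pullback π) l x m) ∧
    (∃! m : ℤ, GIT.HasMu Φ l (x ≫ π) m) ∧
    GIT.mu (Φ.pullback π) l x = GIT.mu Φ l (x ≫ π) := by
  have := hX.isProper
  have := hY.isProper
  exact mainTheorem11_general π hL.lineBundle Φ x l
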